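/- For a real or integer $s\ge 0$ write $\langle s\rangle=\{-\lfloor s/2\rfloor,\dots,\lfloor s/2\rfloor\}$, and write $[r]=\{1,\dots,r\}$ and $\log=\log_2$. For odd $m$ identify $\mathbb{Z}_m$ with $\langle m\rangle$. The $k$-Tree algorithm over $\mathbb{Z}_m$, with $k$ a power of $2$ and a parameter $p\in(0,1]$, takes lists $L_1,\dots,L_k$, each of $n$ elements of $\langle m\rangle$, and works as follows. Put $L^0_i=L_i$ and $\tau_0=m/2$. For $d=1,\dots,\log k$ put $\tau_d=p\,\tau_{d-1}$, and for each $i\in[k/2^d]$ let $L^d_i$ be the list of all sums $a+b$ modulo $m$ (with representative in $\langle m\rangle$) with $a$ an entry of $L^{d-1}_{2i-1}$, $b$ an entry of $L^{d-1}_{2i}$, and $|(a+b) \bmod m|\le\tau_d$, one copy for each such pair. If $L^{\log k}_1$ contains $0$, output indices $(\ell_1,\dots,\ell_k)\in[n]^k$ of input elements that led to such an entry (if there are several, those of the first one); otherwise output $\bot$. **Theorem.** Let $k,n,m$ be positive integers, where $k\ge4$ is a power of $2$ and $m>30^{\log k+1}$ is odd. Set $p=m^{-1/(\log k+1)}$ and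 $c=pn$. Let $L_1,\dots,L_k$ be lists of $n$ elements each, all $kn$ elements being independent and uniformly random in $\langle m\rangle$. Then the $k$-Tree algorithm over $\mathbb{Z}_m$ with filtering parameter $p$ satisfies the following. * Success probability: $$\frac{1}{c^{-k}+\left(1+\frac kn\right)^k}\cdot\max(0,\,1-150p)^k\;\le\;\Pr_{L_1,\dots,L_k}\left[\text{the algorithm outputs }(\ell_1,\dots,\ell_k)\text{ with }\sum_i L_i[\ell_i]=0\text{ in }\mathbb{Z}_m\right]\;\le\;c^k(1+37p)^k .$$ * Complexity: the expected total size $\mathbb{E}\big[\sum_{d=0}^{\log k}\sum_{i\in[k/2^d]}|L^d_i|\big]$ of all the lists, input lists included, lies between $$kn\left(1+\sum_{d\in[\log k]}\frac{c^{2^d-1}}{2^d}\right)(1-37p)^{k-1}\quad\text{and}\quad kn\left(1+\sum_{d\in[\log k]}\frac{c^{2^d-1}}{2^d}\right)(1+37p)^{k-1}.$$ -/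

import Mathlib

open MeasureTheory

noncomputable section

namespace KTree

/-- The set of integers `{-⌊m/2⌋, …, ⌊m/2⌋}`. For odd `m` it has exactly `m` elements and is
a complete system of representatives of `ℤ/mℤ`. -/
def centeredRange (m : ℕ) : Finset ℤ :=
  Finset.Icc (-((m / 2 : ℕ) : ℤ)) ((m / 2 : ℕ) : ℤ)

/-- Addition modulo `m`. For odd `m` the result is the representative in `centeredRange m`. -/
def addMod (m : ℕ) (a b : ℤ) : ℤ := Int.bmod (a + b) m

/-- An entry of a list handled by the algorithm: its value, together with the bookkeeping record
of the positions, in the input lists that were combined, of the elements that led to it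
(in the order of those input lists). -/
structure Entry (n : ℕ) where
  value : ℤ
  indices : List (Fin n)

/-- `Merge(La, Lb, τ)` over `ℤ/mℤ`: one entry for every pair `(a, b)` of an entry of `La` and an
entry of `Lb` whose sum modulo `m` has absolute value at most `τ`. Duplicates are kept. -/
def merge {n : ℕ} (m : ℕ) (La Lb : List (Entry n)) (τ : ℝ) : List (Entry n) :=
  La.flatMap fun a => Lb.filterMap fun b =>
    if |(addMod m a.value b.value : ℝ)| ≤ τ then
      some ⟨addMod m a.value b.value, a.indices ++ b.indices⟩
    else none

/-- The threshold `τ` in iteration `d`: it starts as `m / 2`, and every iteration multiplies it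
by `p`. -/
def threshold (m : ℕ) (p : ℝ) : ℕ → ℝ
  | 0 => (m : ℝ) / 2
  | d + 1 => p * threshold m p d

/-- The lists of the algorithm, counted from zero: `level m p L d i` is the list number `i` after
`d` iterations. For `d = 0` these are the `k` input lists; list `i` of iteration `d + 1` is the
merge of the lists `2 i` and `2 i + 1` of iteration `d`. After `d` iterations the algorithm holds
the lists with `i < k / 2 ^ d`. -/
def level {k n : ℕ} (m : ℕ) (p : ℝ) (L : Fin k → Fin n → ℤ) : ℕ → ℕ → List (Entry n)
  | 0, i => if h : i < k then List.ofFn fun j : Fin n => ⟨L ⟨i, h⟩ j, [j]⟩ else []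
  | d + 1, i =>
      merge m (level m p L d (2 * i)) (level m p L d (2 * i + 1)) (threshold m p (d + 1))

/-- The output of the `k`-Tree algorithm over `ℤ/mℤ` with filtering parameter `p` (for `k` a power
of two): the positions that led to the first `0` in the final list, and `none` (failure) if the
final list does not contain `0`. -/
def output {k n : ℕ} (m : ℕ) (p : ℝ) (L : Fin k → Fin n → ℤ) : Option (List (Fin n)) :=
  ((level m p L (Nat.log 2 k) 0).find? fun e => decide (e.value = 0)).map Entry.indices

/-- The algorithm outputs `ℓ₁, …, ℓₖ` such that `∑ i, L i (ℓ i) = 0` in `ℤ/mℤ`. -/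
def Succeeds {k n : ℕ} (m : ℕ) (p : ℝ) (L : Fin k → Fin n → ℤ) : Prop :=
  ∃ ℓ : Fin k → Fin n,
    output m p L = some (List.ofFn ℓ) ∧ ∑ i, L i (ℓ i) ≡ 0 [ZMOD (m : ℤ)]

/-- The total size of all lists (input, intermediate and final) of an execution. -/
def totalSize {k n : ℕ} (m : ℕ) (p : ℝ) (L : Fin k → Fin n → ℤ) : ℕ :=
  ∑ d ∈ Finset.range (Nat.log 2 k + 1), ∑ i ∈ Finset.range (k / 2 ^ d), (level m p L d i).length

/-- The possible inputs: `k` lists, each of `n` elements of `centeredRange m`. -/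
abbrev Inputs (k n m : ℕ) : Type := Fin k → Fin n → centeredRange m

/-- The lists of an input as lists of integers. -/
def Inputs.lists {k n m : ℕ} (L : Inputs k n m) : Fin k → Fin n → ℤ := fun i j => (L i j : ℤ)

/-- The uniform distribution on the inputs: all `k * n` elements are independent and uniform in
`centeredRange m`. -/
def inputMeasure (k n m : ℕ) : Measure (Inputs k n m) :=
  ProbabilityTheory.uniformOn Set.univ

/-- The probability that the algorithm succeeds on uniformly random input lists. -/
def successProb (k n m : ℕ) (p : ℝ) : ℝ :=
  (inputMeasure k n m).real {L | Succeeds m p L.lists}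

/-- The expected total size of all lists on uniformly random input lists. -/
def expectedComplexity (k n m : ℕ) (p : ℝ) : ℝ :=
  ∫ L, (totalSize m p (Inputs.lists L) : ℝ) ∂(inputMeasure k n m)

end KTree

end

/-! Let `X` be the number of zero entries of the final list. Success means `X ≠ 0` (`succeeds_iff`),
so Markov gives `P ≤ E X` and Cauchy–Schwarz gives `P ≥ (E X)² / E X²` (`inputMean_sq_le`).

Both moments come from a recursion on the number of entries with a given residue: merging convolves
the counts of the two children and cuts off to a window (`levelCount_succ`). The children read
disjoint blocks of input lists, hence are independent, so means and mixed second moments satisfy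
closed recursions. These need only the window sizes. Since `p ^ (t + 1) * m = 1`, the window at
depth `d ≤ t` has `p ^ d * m` residues up to a relative error `p`, and for `z` in the next window
almost every `a` in this one has `z - a` in it too. Each merge thus costs one factor `1 + p` or `1 -
2 * p`, and the mean of `X` is about `c ^ k`.

The second moment keeps the shape `μ² G + [u = v] μ` (`pairMean_le`): the diagonal term accounts for
a tuple paired with itself, and `G = overlap p c d` for tuples sharing only part of their entries.
Bounding `G` separately for `c ≥ 1` and `c ≤ 1` produces the denominator of the lower bound.
Expected list lengths are the means summed over all residues. -/

open MeasureTheory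

noncomputable section

namespace KTree

/-! ### Independence under the uniform distribution on a finite power. -/

section Independence

variable {ι X : Type*} [Fintype ι] [DecidableEq ι] [Fintype X]

/-- Exchanging the coordinates outside `S` between two families. -/
def swapOutside (S : Set ι) [DecidablePred (· ∈ S)] : (ι → X) × (ι → X) ≃ (ι → X) × (ι → X) where
  toFun x := (fun i => if i ∈ S then x.1 i else x.2 i, fun i => if i ∈ S then x.2 i else x.1 i)
  invFun x := (fun i => if i ∈ S then x.1 i else x.2 i, fun i => if i ∈ S then x.2 i else x.1 i)
  left_inv x := by
    ext i <;> by_cases h : i ∈ S <;> simp [h]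
  right_inv x := by
    ext i <;> by_cases h : i ∈ S <;> simp [h]

/-- Under the uniform distribution on a finite power, functions of disjoint sets of coordinates are
uncorrelated. -/
theorem expect_mul_of_dependsOn [Nonempty X] {S T : Set ι} (hST : Disjoint S T) {f g : (ι → X) → ℝ}
    (hf : DependsOn f S) (hg : DependsOn g T) :
    (Finset.univ.expect fun ω => f ω * g ω) = Finset.univ.expect f * Finset.univ.expect g := by
  classical
  -- On pairs of families the swap fixes what `f` sees and replaces what `g` sees by the second
  -- family.
  have key : ∑ x : (ι → X) × (ι → X), f x.1 * g x.1 = ∑ x : (ι → X) × (ι → X), f x.1 * g x.2 := by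
    rw [← (swapOutside S).sum_comp (fun x => f x.1 * g x.1)]
    refine Finset.sum_congr rfl fun x _ => ?_
    congr 1
    · exact hf fun i hi => by simp [swapOutside, hi]
    · exact hg fun i hi => by simp [swapOutside, hST.notMem_of_mem_right hi]
  rw [Fintype.sum_prod_type, Fintype.sum_prod_type] at key
  simp only [Finset.sum_const, ← Finset.mul_sum, ← Finset.sum_mul, nsmul_eq_mul] at key
  simp only [Fintype.expect_eq_sum_div_card]
  have h0 : (Fintype.card (ι → X) : ℝ) ≠ 0 := by exact_mod_cast Fintype.card_ne_zero
  rw [Finset.card_univ] at key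
  rw [div_mul_div_comm, ← key]
  field_simp

/-- A coordinate of a uniformly random family is uniformly distributed. -/
theorem expect_eval [Nonempty X] (i : ι) (F : X → ℝ) :
    (Finset.univ.expect fun ω : ι → X => F (ω i)) = Finset.univ.expect F := by
  have h0 : (Fintype.card ({j // j ≠ i} → X) : ℝ) ≠ 0 := by exact_mod_cast Fintype.card_ne_zero
  have h1 : (Fintype.card X : ℝ) ≠ 0 := by exact_mod_cast Fintype.card_ne_zero
  have h2 : (Fintype.card (ι → X) : ℝ)
      = Fintype.card X * Fintype.card ({j // j ≠ i} → X) := by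
    rw [← Nat.cast_mul, ← Fintype.card_prod, Fintype.card_congr (Equiv.funSplitAt i X)]
  rw [Fintype.expect_eq_sum_div_card, Fintype.expect_eq_sum_div_card, h2,
    ← (Equiv.funSplitAt i X).symm.sum_comp (fun ω => F (ω i)), Fintype.sum_prod_type]
  simp [Equiv.funSplitAt, Equiv.piSplitAt, ← Finset.mul_sum]
  field_simp

end Independence

/-- The expectation of `f` on uniformly random input lists. -/
def inputMean {k n m : ℕ} (f : Inputs k n m → ℝ) : ℝ := Finset.univ.expect f

theorem zero_mem_centeredRange (m : ℕ) : (0 : ℤ) ∈ centeredRange m := by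
  simp [centeredRange]; positivity

instance (m : ℕ) : Nonempty (centeredRange m) := ⟨⟨0, zero_mem_centeredRange m⟩⟩

instance (k n m : ℕ) : IsProbabilityMeasure (inputMeasure k n m) :=
  ProbabilityTheory.isProbabilityMeasure_uniformOn Set.finite_univ Set.univ_nonempty

theorem integral_inputMeasure {k n m : ℕ} (f : Inputs k n m → ℝ) :
    ∫ L, f L ∂(inputMeasure k n m) = inputMean f := by
  rw [integral_fintype (Integrable.of_finite), inputMean, Fintype.expect_eq_sum_div_card,
    Finset.sum_div]
  refine Finset.sum_congr rfl fun L _ => ?_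
  have : (inputMeasure k n m).real {L} = (Fintype.card (Inputs k n m) : ℝ)⁻¹ := by
    rw [inputMeasure, measureReal_def, ProbabilityTheory.uniformOn_univ]
    simp
  rw [this, smul_eq_mul]; field_simp

theorem inputMeasure_real {k n m : ℕ} (s : Set (Inputs k n m)) :
    (inputMeasure k n m).real s = inputMean (s.indicator 1) := by
  rw [← integral_inputMeasure, integral_indicator_one s.toFinite.measurableSet]

/-! ### Residue counts of the lists and correctness of the output. -/

section Counts

variable {n m : ℕ}

/-- For even `m` the two conventions differ in the sign given to `m / 2`; oddness removes that
boundary case. -/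
theorem bmod_eq_valMinAbs [NeZero m] (hm : Odd m) (x : ℤ) :
    Int.bmod x m = ((x : ZMod m)).valMinAbs := by
  have hpos : 0 < m := NeZero.pos m
  refine ((ZMod.valMinAbs_spec _ _).2 ⟨?_, ?_⟩).symm
  · rw [ZMod.intCast_eq_intCast_iff]
    exact (Int.bmod_emod).symm
  · have h1 := Int.le_bmod (x := x) hpos
    have h2 := Int.bmod_lt (x := x) hpos
    obtain ⟨j, rfl⟩ := hm
    push_cast at h1 h2 ⊢
    constructor <;> omega

/-- The number of entries of a list with residue `z`. -/
def countResidue (m : ℕ) (La : List (Entry n)) (z : ZMod m) : ℕ :=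
  La.countP fun e => decide ((e.value : ZMod m) = z)

theorem sum_map_eq_sum_countResidue [NeZero m] (La : List (Entry n)) (f : ZMod m → ℕ) :
    (La.map fun e => f (e.value : ZMod m)).sum = ∑ z, countResidue m La z * f z := by
  induction La with
  | nil => simp [countResidue]
  | cons a La ih =>
    rw [List.map_cons, List.sum_cons, ih]
    simp only [countResidue, List.countP_cons, add_mul, Finset.sum_add_distrib, decide_eq_true_eq,
      ite_mul, one_mul, zero_mul, Finset.sum_ite_eq, Finset.mem_univ, if_true]
    omega

theorem length_eq_sum_countResidue [NeZero m] (La : List (Entry n)) :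
    La.length = ∑ z : ZMod m, countResidue m La z := by
  simpa using sum_map_eq_sum_countResidue (m := m) La fun _ => 1

/-- The filter depends only on the residue of the sum, so it can be pulled out of the convolution.
-/
theorem countResidue_merge [NeZero m] (hm : Odd m) (La Lb : List (Entry n)) (τ : ℝ) (z : ZMod m) :
    countResidue m (merge m La Lb τ) z = if |(z.valMinAbs : ℝ)| ≤ τ then
      ∑ a, countResidue m La a * countResidue m Lb (z - a) else 0 := by
  have inner (a : Entry n) : countResidue m (Lb.filterMap fun b =>
      if |(addMod m a.value b.value : ℝ)| ≤ τ then
        some (⟨addMod m a.value b.value, a.indices ++ b.indices⟩ : Entry n) else none) z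
      = if |(z.valMinAbs : ℝ)| ≤ τ then countResidue m Lb (z - (a.value : ZMod m)) else 0 := by
    induction Lb with
    | nil => simp [countResidue]
    | cons b Lb ih =>
      have hcast : ((addMod m a.value b.value : ℤ) : ZMod m) = (a.value : ZMod m) + b.value := by
        rw [addMod, bmod_eq_valMinAbs hm, ZMod.coe_valMinAbs, Int.cast_add]
      have hval : (addMod m a.value b.value : ℤ)
          = ((a.value : ZMod m) + (b.value : ZMod m)).valMinAbs := by
        rw [addMod, bmod_eq_valMinAbs hm, Int.cast_add]
      have hiff : (a.value : ZMod m) + b.value = z ↔ (b.value : ZMod m) = z - a.value := by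
        rw [eq_sub_iff_add_eq, add_comm]
      simp only [countResidue, List.filterMap_cons, List.countP_cons] at ih ⊢
      by_cases h : |(addMod m a.value b.value : ℝ)| ≤ τ
      · simp only [h, if_true, List.countP_cons, ih, hcast, hiff, decide_eq_true_eq]
        by_cases hb : (b.value : ZMod m) = z - a.value
        · have : |(z.valMinAbs : ℝ)| ≤ τ := by rwa [hval, hiff.2 hb] at h
          simp [hb, this]
        · simp [hb]
      · simp only [h, if_false, ih, decide_eq_true_eq]
        by_cases hb : (b.value : ZMod m) = z - a.value
        · have : ¬ |(z.valMinAbs : ℝ)| ≤ τ := by rwa [hval, hiff.2 hb] at h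
          simp [this]
        · simp [hb]
  have outer : countResidue m (merge m La Lb τ) z = (La.map fun a =>
      if |(z.valMinAbs : ℝ)| ≤ τ then countResidue m Lb (z - (a.value : ZMod m)) else 0).sum := by
    rw [countResidue, merge, List.countP_flatMap]
    congr 1
    exact List.map_congr_left fun a _ => inner a
  rw [outer, sum_map_eq_sum_countResidue La
    fun a => if |(z.valMinAbs : ℝ)| ≤ τ then countResidue m Lb (z - a) else 0]
  split_ifs <;> simp

/-- The number of entries with residue `z` in list `i` after `d` iterations. -/
def levelCount {k : ℕ} (m : ℕ) (p : ℝ) (d i : ℕ) (z : ZMod m) (L : Inputs k n m) : ℝ :=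
  countResidue m (level m p L.lists d i) z

/-- The residues that pass the filter of iteration `d`. -/
def window (m : ℕ) [NeZero m] (p : ℝ) (d : ℕ) : Finset (ZMod m) :=
  Finset.univ.filter fun z => |(z.valMinAbs : ℝ)| ≤ threshold m p d

theorem levelCount_succ {k : ℕ} [NeZero m] (hm : Odd m) (p : ℝ) (d i : ℕ) (z : ZMod m)
    (L : Inputs k n m) :
    levelCount m p (d + 1) i z L = if z ∈ window m p (d + 1) then
      ∑ a, levelCount m p d (2 * i) a L * levelCount m p d (2 * i + 1) (z - a) L else 0 := by
  simp only [levelCount, level, countResidue_merge hm, window, Finset.mem_filter, Finset.mem_univ,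
    true_and]
  split_ifs <;> simp

theorem window_zero [NeZero m] (p : ℝ) : window m p 0 = Finset.univ := by
  refine Finset.filter_true_of_mem fun z _ => ?_
  have h := ZMod.natAbs_valMinAbs_le z
  have h2 : 2 * |z.valMinAbs| ≤ m := by
    rw [Int.abs_eq_natAbs]
    omega
  have h3 : (2 : ℝ) * |(z.valMinAbs : ℝ)| ≤ m := by exact_mod_cast h2
  simp only [threshold]
  linarith

/-- This locality is the source of independence: sibling lists are computed from disjoint blocks of
inputs. -/
theorem level_congr {k : ℕ} (p : ℝ) {L L' : Fin k → Fin n → ℤ} (d i : ℕ)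
    (h : ∀ j : Fin k, j.val / 2 ^ d = i → L j = L' j) :
    level m p L d i = level m p L' d i := by
  induction d generalizing i with
  | zero =>
    simp only [level]
    split_ifs with hi
    · rw [h ⟨i, hi⟩ (by simp)]
    · rfl
  | succ d ih =>
    have aux (i' : ℕ) (hi' : i' / 2 = i) : level m p L d i' = level m p L' d i' :=
      ih _ fun j hj => h j (by rw [pow_succ, ← Nat.div_div_eq_div_mul, hj, hi'])
    simp only [level]
    rw [aux (2 * i) (by omega), aux (2 * i + 1) (by omega)]

theorem dependsOn_levelCount {k : ℕ} (p : ℝ) (d i : ℕ) (z : ZMod m) :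
    DependsOn (levelCount (k := k) (n := n) m p d i z) {j | j.val / 2 ^ d = i} := by
  intro L L' h
  simp only [levelCount]
  rw [level_congr p d i fun j hj => ?_]
  ext l
  simp [Inputs.lists, h j hj]

/-- Taking `ℓ` on all of `ℕ`, indexed by absolute list number, lets the witnesses of the two
children be glued by a single case distinction. -/
theorem sum_indices_of_mem_level {k : ℕ} [NeZero m] (hm : Odd m) (p : ℝ) (L : Fin k → Fin n → ℤ)
    (d i : ℕ) (e : Entry n) (he : e ∈ level m p L d i) :
    ∃ ℓ : ℕ → Fin n, e.indices = (List.range (2 ^ d)).map (fun j => ℓ (i * 2 ^ d + j)) ∧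
      (e.value : ZMod m) = ∑ j ∈ Finset.range (2 ^ d),
        if h : i * 2 ^ d + j < k then (L ⟨i * 2 ^ d + j, h⟩ (ℓ (i * 2 ^ d + j)) : ZMod m) else 0 := by
  induction d generalizing i e with
  | zero =>
    simp only [level] at he
    split_ifs at he with hi
    · obtain ⟨j, rfl⟩ := List.mem_ofFn.1 he
      exact ⟨fun _ => j, by simp, by simp [hi]⟩
    · simp at he
  | succ d ih =>
    simp only [level, merge, List.mem_flatMap, List.mem_filterMap] at he
    obtain ⟨a, ha, b, hb, hab⟩ := he
    split_ifs at hab with hτ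
    obtain ⟨ℓa, hai, hav⟩ := ih _ a ha
    obtain ⟨ℓb, hbi, hbv⟩ := ih _ b hb
    have e1 : i * 2 ^ (d + 1) = 2 * i * 2 ^ d := by ring
    have e2 (j : ℕ) : 2 * i * 2 ^ d + (2 ^ d + j) = (2 * i + 1) * 2 ^ d + j := by ring
    have l1 (j : ℕ) (hj : j < 2 ^ d) : 2 * i * 2 ^ d + j < (2 * i + 1) * 2 ^ d := by
      rw [add_mul]; omega
    have l2 (j : ℕ) : ¬ (2 * i + 1) * 2 ^ d + j < (2 * i + 1) * 2 ^ d := by omega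
    refine ⟨fun x => if x < (2 * i + 1) * 2 ^ d then ℓa x else ℓb x, ?_, ?_⟩
    · rw [← Option.some.inj hab]
      simp only [hai, hbi]
      rw [pow_succ, mul_two, List.range_add, List.map_append, List.map_map, ← mul_two, ← pow_succ]
      congr 1
      · refine List.map_congr_left fun j hj => ?_
        rw [e1, if_pos (l1 j (List.mem_range.1 hj))]
      · refine List.map_congr_left fun j hj => ?_
        simp only [Function.comp_apply]
        rw [e1, e2, if_neg (l2 j)]
    · rw [← Option.some.inj hab]
      simp only [addMod]
      rw [bmod_eq_valMinAbs hm, ZMod.coe_valMinAbs, Int.cast_add, hav, hbv]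
      rw [show Finset.range (2 ^ (d + 1)) = Finset.range (2 ^ d + 2 ^ d) by
        rw [pow_succ, mul_two], Finset.sum_range_add]
      congr 1
      · refine Finset.sum_congr rfl fun j hj => ?_
        simp only [e1, if_pos (l1 j (Finset.mem_range.1 hj))]
      · refine Finset.sum_congr rfl fun j hj => ?_
        simp only [e1, e2, if_neg (l2 j)]

/-- Merged values are already reduced, so residue `0` forces the integer value `0` that `output`
tests for. -/
theorem valMinAbs_value_of_mem_level {k : ℕ} [NeZero m] (hm : Odd m) (p : ℝ)
    (L : Fin k → Fin n → ℤ) (d i : ℕ) (e : Entry n) (he : e ∈ level m p L (d + 1) i) :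
    (e.value : ZMod m).valMinAbs = e.value := by
  simp only [level, merge, List.mem_flatMap, List.mem_filterMap] at he
  obtain ⟨a, -, b, -, hab⟩ := he
  split_ifs at hab with hτ
  rw [← Option.some.inj hab]
  simp only [addMod]
  rw [bmod_eq_valMinAbs hm, ZMod.coe_valMinAbs]

/-- The recorded positions always sum to the value of their entry modulo `m`, so any output
whatsoever is a correct solution. -/
theorem succeeds_iff {t : ℕ} (ht : 0 < t) [NeZero m] (hm : Odd m) (p : ℝ)
    (L : Inputs (2 ^ t) n m) :
    Succeeds m p L.lists ↔ levelCount m p t 0 0 L ≠ 0 := by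
  obtain ⟨t, rfl⟩ : ∃ s, t = s + 1 := ⟨t - 1, by omega⟩
  have hlog : Nat.log 2 (2 ^ (t + 1)) = t + 1 := Nat.log_pow (by norm_num) _
  have hcount : levelCount m p (t + 1) 0 0 L ≠ 0 ↔
      ∃ e ∈ level m p L.lists (t + 1) 0, (e.value : ZMod m) = 0 := by
    rw [levelCount, countResidue, Nat.cast_ne_zero, ← Nat.pos_iff_ne_zero, List.countP_pos_iff]
    simp
  rw [hcount, Succeeds, output, hlog]
  constructor
  · rintro ⟨ℓ, hℓ, -⟩
    obtain ⟨e, he, -⟩ := Option.map_eq_some_iff.1 hℓ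
    have h0 : e.value = 0 := by simpa using List.find?_some he
    exact ⟨e, List.mem_of_find?_eq_some he, by simp [h0]⟩
  · rintro ⟨e, he, h0⟩
    have hv : e.value = 0 := by
      rw [← valMinAbs_value_of_mem_level hm p _ _ _ e he, h0, ZMod.valMinAbs_zero]
    obtain ⟨e', he'⟩ : ∃ e', (level m p L.lists (t + 1) 0).find?
        (fun e => decide (e.value = 0)) = some e' := by
      rw [← Option.isSome_iff_exists, List.find?_isSome]
      exact ⟨e, he, by simpa using hv⟩
    have hv' : e'.value = 0 := by simpa using List.find?_some he'
    obtain ⟨ℓ, hi, hs⟩ := sum_indices_of_mem_level hm p _ _ _ e' (List.mem_of_find?_eq_some he')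
    refine ⟨fun j => ℓ j, ?_, ?_⟩
    · rw [he', Option.map_some, hi]
      congr 1
      refine List.ext_getElem (by simp) fun j h1 h2 => ?_
      simp
    · rw [← ZMod.intCast_eq_intCast_iff, Int.cast_sum, Int.cast_zero, ← Int.cast_zero, ← hv', hs,
        Finset.sum_range]
      refine Finset.sum_congr rfl fun j _ => ?_
      simp

end Counts

/-! ### Recursions for the first and second moments, and their initial values. -/

section Moments

variable {k n m : ℕ}

theorem inputMean_mul_of_dependsOn {S T : Set (Fin k)} (hST : Disjoint S T)
    {f g : Inputs k n m → ℝ} (hf : DependsOn f S) (hg : DependsOn g T) :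
    (inputMean fun L => f L * g L) = inputMean f * inputMean g :=
  expect_mul_of_dependsOn hST hf hg

theorem inputMean_sum {ι : Type*} (s : Finset ι) (f : ι → Inputs k n m → ℝ) :
    (inputMean fun L => ∑ a ∈ s, f a L) = ∑ a ∈ s, inputMean (f a) :=
  Finset.expect_sum_comm _ _ _

theorem inputMean_mono {f g : Inputs k n m → ℝ} (h : ∀ L, f L ≤ g L) :
    inputMean f ≤ inputMean g :=
  Finset.expect_le_expect fun L _ => h L

theorem inputMean_nonneg {f : Inputs k n m → ℝ} (h : ∀ L, 0 ≤ f L) : 0 ≤ inputMean f :=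
  Finset.expect_nonneg fun L _ => h L

theorem inputMean_const (c : ℝ) : (inputMean fun _ : Inputs k n m => c) = c :=
  Finset.expect_const Finset.univ_nonempty c

theorem disjoint_blocks (k d i : ℕ) :
    Disjoint {j : Fin k | j.val / 2 ^ d = 2 * i} {j : Fin k | j.val / 2 ^ d = 2 * i + 1} := by
  rw [Set.disjoint_left]
  intro j h1 h2
  simp only [Set.mem_ofPred_eq] at h1 h2
  omega

theorem dependsOn_mul {ι : Type*} {α : ι → Type*} {f g : (∀ i, α i) → ℝ} {S : Set ι}
    (hf : DependsOn f S) (hg : DependsOn g S) : DependsOn (fun x => f x * g x) S :=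
  fun x y h => by simp only [hf h, hg h]

theorem inputMean_levelCount_succ [NeZero m] (hm : Odd m) (p : ℝ) (d i : ℕ) (z : ZMod m) :
    inputMean (levelCount (k := k) (n := n) m p (d + 1) i z) = if z ∈ window m p (d + 1) then
      ∑ a, inputMean (levelCount (k := k) (n := n) m p d (2 * i) a) *
        inputMean (levelCount (k := k) (n := n) m p d (2 * i + 1) (z - a)) else 0 := by
  rw [show levelCount (k := k) (n := n) m p (d + 1) i z = _ from
    funext fun L => levelCount_succ hm p d i z L]
  split_ifs with hz
  · rw [inputMean_sum]
    exact Finset.sum_congr rfl fun a _ => inputMean_mul_of_dependsOn (disjoint_blocks k d i)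
      (dependsOn_levelCount p d _ _) (dependsOn_levelCount p d _ _)
  · exact inputMean_const 0

/-- The mixed second moment of two entry counts of one list. -/
def pairMean (k n m : ℕ) (p : ℝ) (d i : ℕ) (u v : ZMod m) : ℝ :=
  inputMean fun L : Inputs k n m => levelCount m p d i u L * levelCount m p d i v L

/-- The recursion couples `(u, v)` to all pairs `(a, b)`, so mixed moments are needed even though
only `u = v = 0` matters in the end. -/
theorem pairMean_succ [NeZero m] (hm : Odd m) (p : ℝ) (d i : ℕ) (u v : ZMod m) :
    pairMean k n m p (d + 1) i u v = if u ∈ window m p (d + 1) ∧ v ∈ window m p (d + 1) then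
      ∑ a, ∑ b, pairMean k n m p d (2 * i) a b * pairMean k n m p d (2 * i + 1) (u - a) (v - b)
      else 0 := by
  unfold pairMean
  simp only [levelCount_succ hm p d i]
  split_ifs with hu hv h h
  · have (a : ZMod m) (b : ZMod m) := inputMean_mul_of_dependsOn (disjoint_blocks k d i)
      (dependsOn_mul (dependsOn_levelCount (n := n) p d (2 * i) a)
        (dependsOn_levelCount p d (2 * i) b))
      (dependsOn_mul (dependsOn_levelCount p d (2 * i + 1) (u - a))
        (dependsOn_levelCount p d (2 * i + 1) (v - b)))
    simp only [← this]
    simp only [← inputMean_sum, Finset.sum_mul_sum]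
    congr 1
    ext L
    exact Finset.sum_congr rfl fun a _ => Finset.sum_congr rfl fun b _ => by ring
  all_goals first | (exfalso; tauto) | simp [inputMean_const]

theorem countP_ofFn {α : Type*} {N : ℕ} (q : α → Bool) (f : Fin N → α) :
    (List.ofFn f).countP q = ∑ j, if q (f j) then 1 else 0 := by
  induction N with
  | zero => simp
  | succ N ih => rw [List.ofFn_succ, List.countP_cons, ih, Fin.sum_univ_succ, add_comm]

theorem levelCount_zero (p : ℝ) {i : ℕ} (hi : i < k) (z : ZMod m) (L : Inputs k n m) :
    levelCount m p 0 i z L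
      = ∑ j, if (((L ⟨i, hi⟩ j : ℤ)) : ZMod m) = z then (1 : ℝ) else 0 := by
  simp [levelCount, countResidue, level, hi, countP_ofFn, Inputs.lists]

theorem expect_residue_eq [NeZero m] (hm : Odd m) (z : ZMod m) :
    (Finset.univ.expect fun x : centeredRange m =>
      if ((x : ℤ) : ZMod m) = z then (1 : ℝ) else 0) = 1 / m := by
  obtain ⟨j, hj⟩ := hm
  have hcard : Fintype.card (centeredRange m) = m := by
    rw [Fintype.card_coe, centeredRange, Int.card_Icc]
    omega
  have habs : z.valMinAbs ∈ centeredRange m := by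
    have := ZMod.natAbs_valMinAbs_le z
    rw [centeredRange, Finset.mem_Icc]
    omega
  have huniq (x : centeredRange m) : ((x : ℤ) : ZMod m) = z ↔ x = ⟨z.valMinAbs, habs⟩ := by
    constructor
    · intro h
      apply Subtype.ext
      refine ((ZMod.valMinAbs_spec z x).2 ⟨h.symm, ?_⟩).symm
      have := Finset.mem_Icc.1 x.2
      constructor <;> omega
    · rintro rfl
      exact ZMod.coe_valMinAbs z
  rw [Fintype.expect_eq_sum_div_card, hcard]
  simp [huniq]

theorem inputMean_levelCount_zero [NeZero m] (hm : Odd m) (p : ℝ) {i : ℕ} (hi : i < k)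
    (z : ZMod m) : inputMean (levelCount (k := k) (n := n) m p 0 i z) = n / m := by
  rw [show levelCount (k := k) (n := n) m p 0 i z = _ from
    funext fun L => levelCount_zero p hi z L, inputMean_sum]
  have (j : Fin n) : (inputMean fun L : Inputs k n m =>
      if (((L ⟨i, hi⟩ j : ℤ)) : ZMod m) = z then (1 : ℝ) else 0) = 1 / m := by
    rw [← expect_residue_eq hm z]
    exact (expect_eval (⟨i, hi⟩ : Fin k) (fun x : Fin n → centeredRange m =>
        if ((x j : ℤ) : ZMod m) = z then (1 : ℝ) else 0)).trans
      (expect_eval j (fun x : centeredRange m => if ((x : ℤ) : ZMod m) = z then (1 : ℝ) else 0))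
  simp [this]
  rfl

/-- Distinct positions are independent and give at most `(n / m)²` in total; a position paired with
itself contributes only if `u = v`. -/
theorem pairMean_zero_le [NeZero m] (hm : Odd m) (p : ℝ) {i : ℕ} (hi : i < k) (u v : ZMod m) :
    pairMean k n m p 0 i u v ≤ ((n : ℝ) / m) ^ 2 + if u = v then (n : ℝ) / m else 0 := by
  have hm0 : (0 : ℝ) < m := by exact_mod_cast NeZero.pos m
  let F (z : ZMod m) (j : Fin n) (x : Fin n → centeredRange m) : ℝ :=
    if ((x j : ℤ) : ZMod m) = z then 1 else 0
  have hF (z : ZMod m) (j : Fin n) : Finset.univ.expect (F z j) = 1 / m := by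
    rw [← expect_residue_eq hm z]
    exact expect_eval j (fun x : centeredRange m => if ((x : ℤ) : ZMod m) = z then (1 : ℝ) else 0)
  have hdep (z : ZMod m) (j : Fin n) : DependsOn (F z j) {j} := by
    intro x y h
    simp [F, h j rfl]
  have hpair (j j' : Fin n) : (Finset.univ.expect fun x => F u j x * F v j' x)
      ≤ (1 / (m : ℝ)) ^ 2 + if j = j' then (if u = v then 1 / (m : ℝ) else 0) else 0 := by
    by_cases hj : j = j'
    · subst hj
      by_cases huv : u = v
      · subst huv
        have : (fun x => F u j x * F u j x) = F u j := by
          ext x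
          simp [F]
        rw [this, hF]
        simp
      · have : (fun x => F u j x * F v j x) = fun _ => 0 := by
          ext x
          by_cases h : ((x j : ℤ) : ZMod m) = u
          · simp [F, h, huv]
          · simp [F, h]
        simp [this, huv]
    · rw [expect_mul_of_dependsOn (by simpa using hj) (hdep u j) (hdep v j'), hF, hF]
      simp [hj, sq]
  have hsum : pairMean k n m p 0 i u v
      = ∑ j, ∑ j', Finset.univ.expect fun x => F u j x * F v j' x := by
    unfold pairMean
    simp only [levelCount_zero p hi, Finset.sum_mul_sum]
    rw [inputMean_sum]
    refine Finset.sum_congr rfl fun j _ => ?_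
    rw [inputMean_sum]
    exact Finset.sum_congr rfl fun j' _ =>
      expect_eval (⟨i, hi⟩ : Fin k) fun x => F u j x * F v j' x
  rw [hsum]
  refine (Finset.sum_le_sum fun j _ => Finset.sum_le_sum fun j' _ => hpair j j').trans
    (le_of_eq ?_)
  simp only [Finset.sum_add_distrib, Finset.sum_const, Finset.card_univ, Fintype.card_fin,
    nsmul_eq_mul, Finset.sum_ite_eq, Finset.mem_univ, if_true]
  split_ifs <;> field_simp
  ring

end Moments

/-! ### Sizes of the windows and of their intersections with reflected translates. -/

section Windows

variable {m : ℕ} {p : ℝ}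

theorem threshold_eq (m : ℕ) (p : ℝ) (d : ℕ) : threshold m p d = p ^ d * m / 2 := by
  induction d with
  | zero => simp [threshold]
  | succ d ih => rw [threshold, ih]; ring

theorem mem_window [NeZero m] (d : ℕ) (z : ZMod m) :
    z ∈ window m p d ↔ |(z.valMinAbs : ℝ)| ≤ threshold m p d := by
  simp [window]

theorem card_window_le (m : ℕ) [NeZero m] (d : ℕ) (h : 0 ≤ threshold m p d) :
    ((window m p d).card : ℝ) ≤ 2 * threshold m p d + 1 := by
  have hf : (0 : ℤ) ≤ ⌊threshold m p d⌋ := Int.floor_nonneg.2 h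
  have hle : (window m p d).card
      ≤ (Finset.Icc (-⌊threshold m p d⌋) ⌊threshold m p d⌋).card := by
    refine Finset.card_le_card_of_injOn ZMod.valMinAbs (fun z hz => ?_)
      (ZMod.injective_valMinAbs.injOn)
    have hz' := (mem_window d z).1 hz
    rw [Finset.mem_coe, Finset.mem_Icc, ← abs_le, Int.le_floor, Int.cast_abs]
    exact hz'
  rw [Int.card_Icc] at hle
  have h2 : ((window m p d).card : ℤ) ≤ 2 * ⌊threshold m p d⌋ + 1 := by omega
  have h3 : ((window m p d).card : ℝ) ≤ 2 * (⌊threshold m p d⌋ : ℝ) + 1 := by exact_mod_cast h2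
  linarith [Int.floor_le (threshold m p d)]

theorem valMinAbs_intCast [NeZero m] {τ : ℤ} (hτ : 2 * τ < m) {a : ℤ} (ha : |a| ≤ τ) :
    (a : ZMod m).valMinAbs = a := by
  rw [abs_le] at ha
  refine (ZMod.valMinAbs_spec _ _).2 ⟨rfl, ?_⟩
  constructor <;> omega

/-- Two integer intervals of radius `τ` with centres `0` and `v` share at least `2τ + 1 - |v|`
points; replacing the real threshold by its floor costs at most `2`. The bound below `m` rules out
wrap-around. -/
theorem le_card_window_inter (m : ℕ) [NeZero m] (d : ℕ) (h : 2 * threshold m p d < m)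
    (z : ZMod m) :
    2 * threshold m p d - 1 - |(z.valMinAbs : ℝ)|
      ≤ ((window m p d).filter fun a => z - a ∈ window m p d).card := by
  set τ : ℤ := ⌊threshold m p d⌋ with hτ
  set v : ℤ := z.valMinAbs with hv
  have hzv : z = (v : ZMod m) := (ZMod.coe_valMinAbs z).symm
  have hτm : 2 * τ < m := by
    have : (2 : ℝ) * τ < m := by linarith [Int.floor_le (threshold m p d)]
    exact_mod_cast this
  have hle : (Finset.Icc (max (-τ) (v - τ)) (min τ (v + τ))).card
      ≤ ((window m p d).filter fun a => z - a ∈ window m p d).card := by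
    refine Finset.card_le_card_of_injOn (fun a : ℤ => (a : ZMod m)) (fun a ha => ?_) ?_
    · rw [Finset.mem_coe, Finset.mem_Icc, max_le_iff, le_min_iff] at ha
      have h1 : |a| ≤ τ := abs_le.2 ⟨ha.1.1, ha.2.1⟩
      have h2 : |v - a| ≤ τ := abs_le.2 ⟨by omega, by omega⟩
      rw [Finset.mem_coe, Finset.mem_filter, mem_window, mem_window, hzv, ← Int.cast_sub,
        valMinAbs_intCast hτm h1, valMinAbs_intCast hτm h2, ← Int.cast_abs, ← Int.cast_abs,
        ← Int.le_floor, ← Int.le_floor]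
      exact ⟨h1, h2⟩
    · intro a ha b hb hab
      rw [Finset.mem_coe, Finset.mem_Icc, max_le_iff, le_min_iff] at ha hb
      rw [← valMinAbs_intCast hτm (abs_le.2 ⟨ha.1.1, ha.2.1⟩),
        ← valMinAbs_intCast hτm (abs_le.2 ⟨hb.1.1, hb.2.1⟩)]
      exact congrArg _ hab
  rw [Int.card_Icc] at hle
  have h2 : 2 * τ + 1 - |v|
      ≤ ((window m p d).filter fun a => z - a ∈ window m p d).card := by
    rcases abs_cases v with ⟨h, _⟩ | ⟨h, _⟩ <;> omega
  have h3 : (2 : ℝ) * τ + 1 - |(v : ℝ)|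
      ≤ ((window m p d).filter fun a => z - a ∈ window m p d).card := by exact_mod_cast h2
  linarith [Int.lt_floor_add_one (threshold m p d)]

variable {t : ℕ}

/-- The relation between the modulus and the filtering parameter of a `t`-level tree. -/
structure TreeParams (m : ℕ) (p : ℝ) (t : ℕ) : Prop where
  pos : 0 < p
  le : p ≤ 1 / 30
  pow_mul : p ^ (t + 1) * m = 1

/-- Rounding errors of size one are at most a fraction `p` of the ideal window size `p ^ d * m`. -/
theorem TreeParams.one_le (h : TreeParams m p t) {d : ℕ} (hd : d ≤ t) : 1 ≤ p * (p ^ d * m) := by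
  rw [← h.pow_mul, ← mul_assoc, ← pow_succ']
  gcongr ?_ * _
  exact pow_le_pow_of_le_one h.pos.le (by linarith [h.le]) (by omega)

theorem TreeParams.window_card_le [NeZero m] (h : TreeParams m p t) {d : ℕ} (hd : d ≤ t) :
    ((window m p d).card : ℝ) ≤ p ^ d * m * (1 + p) := by
  have hp := h.pos
  have hm0 : (0 : ℝ) < m := by exact_mod_cast NeZero.pos m
  have h1 := h.one_le hd
  refine (card_window_le m d ?_).trans ?_
  · rw [threshold_eq]; positivity
  · rw [threshold_eq]; linarith

theorem TreeParams.two_threshold_lt [NeZero m] (h : TreeParams m p t) {d : ℕ} (hd : d ≠ 0) :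
    2 * threshold m p d < m := by
  have hm0 : (0 : ℝ) < m := by exact_mod_cast NeZero.pos m
  have : p ^ d < 1 := pow_lt_one₀ h.pos.le (by linarith [h.le]) hd
  rw [threshold_eq]
  nlinarith

theorem TreeParams.le_window_card [NeZero m] (h : TreeParams m p t) {d : ℕ} (hd : d ≤ t) :
    p ^ d * m * (1 - p) ≤ ((window m p d).card : ℝ) := by
  have hp := h.pos
  have hm0 : (0 : ℝ) < m := by exact_mod_cast NeZero.pos m
  rcases eq_or_ne d 0 with rfl | hd0
  · rw [window_zero, Finset.card_univ, ZMod.card]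
    nlinarith
  · have h1 := le_card_window_inter m d (h.two_threshold_lt hd0) 0
    have h2 := h.one_le hd
    rw [threshold_eq, ZMod.valMinAbs_zero, Int.cast_zero, abs_zero] at h1
    have h3 : (((window m p d).filter fun a => 0 - a ∈ window m p d).card : ℝ)
        ≤ (window m p d).card := by exact_mod_cast Finset.card_filter_le _ _
    linarith

/-- The shift `|z| ≤ p ^ (d + 1) * m / 2` loses a fraction `p / 2` and rounding loses at most `p`.
Depth `0` is separate: its window is all of `ZMod m`, where wrap-around does occur. -/
theorem TreeParams.le_window_inter_card [NeZero m] (h : TreeParams m p t) {d : ℕ} (hd : d < t)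
    {z : ZMod m} (hz : z ∈ window m p (d + 1)) : p ^ d * m * (1 - 2 * p)
      ≤ ((window m p d).filter fun a => z - a ∈ window m p d).card := by
  have hp := h.pos
  have hm0 : (0 : ℝ) < m := by exact_mod_cast NeZero.pos m
  rcases eq_or_ne d 0 with rfl | hd0
  · simp only [window_zero, Finset.mem_univ, Finset.filter_true, Finset.card_univ, ZMod.card]
    nlinarith
  · have hz1 := (mem_window _ _).1 hz
    have hpm : 0 < p ^ d * m := by positivity
    have h1 := le_card_window_inter m d (h.two_threshold_lt hd0) z
    have h2 := h.one_le hd.le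
    rw [threshold_eq] at h1
    rw [threshold_eq, pow_succ'] at hz1
    nlinarith

end Windows

/-! ### Solving the moment recursions. -/

section Bounds

variable {k n m t : ℕ} {p c : ℝ}

/-- The idealised expected number of entries with a given residue in a list after `d`
iterations. -/
def mass (m : ℕ) (p c : ℝ) (d : ℕ) : ℝ := c ^ 2 ^ d / (p ^ (d + 1) * m)

theorem two_pow_succ_pred (d : ℕ) : 2 ^ (d + 1) - 1 = 2 * (2 ^ d - 1) + 1 := by
  have := Nat.one_le_two_pow (n := d)
  rw [pow_succ]
  omega

theorem mass_pos [NeZero m] (hp : 0 < p) (hc : 0 < c) (d : ℕ) : 0 < mass m p c d := by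
  have hm0 : (0 : ℝ) < m := by exact_mod_cast NeZero.pos m
  unfold mass
  positivity

theorem mass_succ [NeZero m] (hp : 0 < p) (d : ℕ) :
    mass m p c (d + 1) = mass m p c d ^ 2 * (p ^ d * m) := by
  have hm0 : (m : ℝ) ≠ 0 := by exact_mod_cast NeZero.ne m
  have := hp.ne'
  unfold mass
  rw [pow_succ 2 d, pow_mul]
  field_simp
  ring

theorem mass_zero [NeZero m] (hp : 0 < p) (hc : c = p * n) : mass m p c 0 = n / m := by
  have hm0 : (m : ℝ) ≠ 0 := by exact_mod_cast NeZero.ne m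
  have := hp.ne'
  rw [mass, hc]
  field_simp
  ring

theorem mass_mul [NeZero m] (hp : 0 < p) (d : ℕ) :
    mass m p c d * (p ^ d * m) = c ^ 2 ^ d / p := by
  have hm0 : (m : ℝ) ≠ 0 := by exact_mod_cast NeZero.ne m
  have := hp.ne'
  rw [mass]
  field_simp
  ring

theorem block_lt {d i : ℕ} (hi : (i + 1) * 2 ^ (d + 1) ≤ k) :
    (2 * i + 1) * 2 ^ d ≤ k ∧ (2 * i + 1 + 1) * 2 ^ d ≤ k := by
  rw [pow_succ] at hi
  constructor <;> nlinarith [Nat.one_le_two_pow (n := d)]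

theorem levelCount_nonneg (d i : ℕ) (z : ZMod m) (L : Inputs k n m) :
    0 ≤ levelCount m p d i z L := Nat.cast_nonneg _

/-- A merge squares the error factor and adds one `1 + p` for the window size; the exponent
recursion `e ↦ 2e + 1` from `0` gives `2 ^ d - 1`. -/
theorem inputMean_levelCount_le [NeZero m] (hm : Odd m) (h : TreeParams m p t) (hn : 0 < n)
    (hc : c = p * n) {d i : ℕ} (hd : d ≤ t) (hi : (i + 1) * 2 ^ d ≤ k) (z : ZMod m) :
    inputMean (levelCount (k := k) (n := n) m p d i z)
      ≤ if z ∈ window m p d then mass m p c d * (1 + p) ^ (2 ^ d - 1) else 0 := by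
  have hp := h.pos
  have hc0 : 0 < c := by rw [hc]; positivity
  have hm0 : (0 : ℝ) < m := by exact_mod_cast NeZero.pos m
  induction d generalizing i z with
  | zero =>
    simp only [pow_zero, mul_one] at hi
    rw [inputMean_levelCount_zero hm p hi, mass_zero hp hc]
    simp [window_zero]
  | succ d ih =>
    rw [inputMean_levelCount_succ hm]
    split_ifs with hz
    swap
    · rfl
    obtain ⟨hi1, hi2⟩ := block_lt hi
    set μ := mass m p c d * (1 + p) ^ (2 ^ d - 1) with hμ
    have hμ0 : 0 ≤ μ := by have := mass_pos (m := m) hp hc0 d; positivity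
    calc _ ≤ ∑ a, (if a ∈ window m p d then μ else 0) * μ := by
          refine Finset.sum_le_sum fun a _ => mul_le_mul (ih (by omega) hi1 a)
            ((ih (by omega) hi2 _).trans ?_) (inputMean_nonneg (levelCount_nonneg _ _ _)) ?_
          · split_ifs <;> simp [hμ0]
          · split_ifs <;> simp [hμ0]
      _ = μ * μ * (window m p d).card := by
          simp [ite_mul, Finset.sum_ite_mem]; ring
      _ ≤ μ * μ * (p ^ d * m * (1 + p)) := by
          gcongr
          exact h.window_card_le (by omega)
      _ = _ := by
          rw [mass_succ hp, hμ, two_pow_succ_pred, pow_succ (1 + p), pow_mul' (1 + p)]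
          ring

theorem le_inputMean_levelCount [NeZero m] (hm : Odd m) (h : TreeParams m p t) (hn : 0 < n)
    (hc : c = p * n) {d i : ℕ} (hd : d ≤ t) (hi : (i + 1) * 2 ^ d ≤ k) (z : ZMod m)
    (hz : z ∈ window m p d) : mass m p c d * (1 - 2 * p) ^ (2 ^ d - 1)
      ≤ inputMean (levelCount (k := k) (n := n) m p d i z) := by
  have hp := h.pos
  have hp1 : 0 ≤ 1 - 2 * p := by linarith [h.le]
  have hc0 : 0 < c := by rw [hc]; positivity
  have hm0 : (0 : ℝ) < m := by exact_mod_cast NeZero.pos m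
  induction d generalizing i z with
  | zero =>
    simp only [pow_zero, mul_one] at hi
    rw [inputMean_levelCount_zero hm p hi, mass_zero hp hc]
    simp
  | succ d ih =>
    rw [inputMean_levelCount_succ hm, if_pos hz]
    obtain ⟨hi1, hi2⟩ := block_lt hi
    set μ := mass m p c d * (1 - 2 * p) ^ (2 ^ d - 1) with hμ
    have hμ0 : 0 ≤ μ := by have := mass_pos (m := m) hp hc0 d; positivity
    calc _ = μ * μ * (p ^ d * m * (1 - 2 * p)) := by
          rw [mass_succ hp, hμ, two_pow_succ_pred, pow_succ (1 - 2 * p), pow_mul' (1 - 2 * p)]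
          ring
      _ ≤ μ * μ * ((window m p d).filter fun a => z - a ∈ window m p d).card := by
          gcongr
          exact h.le_window_inter_card (by omega) hz
      _ = ∑ a ∈ (window m p d).filter fun a => z - a ∈ window m p d, μ * μ := by
          simp; ring
      _ ≤ ∑ a ∈ (window m p d).filter fun a => z - a ∈ window m p d,
          inputMean (levelCount (k := k) (n := n) m p d (2 * i) a) *
            inputMean (levelCount (k := k) (n := n) m p d (2 * i + 1) (z - a)) := by
          refine Finset.sum_le_sum fun a ha => ?_
          obtain ⟨ha1, ha2⟩ := Finset.mem_filter.1 ha
          exact mul_le_mul (ih (by omega) hi1 a ha1) (ih (by omega) hi2 _ ha2) hμ0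
            (inputMean_nonneg (levelCount_nonneg _ _ _))
      _ ≤ _ := Finset.sum_le_sum_of_subset_of_nonneg (Finset.subset_univ _) fun a _ _ =>
          mul_nonneg (inputMean_nonneg (levelCount_nonneg _ _ _))
            (inputMean_nonneg (levelCount_nonneg _ _ _))

/-- The factor by which the second moment of an entry count exceeds the square of the mean, where
the contribution of pairs of equal index tuples is left out. -/
def overlap (p c : ℝ) : ℕ → ℝ
  | 0 => 1
  | d + 1 => overlap p c d ^ 2 + 2 * overlap p c d * (p / c ^ 2 ^ d)

theorem one_le_overlap (hp : 0 < p) (hc : 0 < c) (d : ℕ) : 1 ≤ overlap p c d := by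
  induction d with
  | zero => exact le_rfl
  | succ d ih =>
    have : 0 ≤ 2 * overlap p c d * (p / c ^ 2 ^ d) := by positivity
    simp only [overlap]
    nlinarith

theorem pairMean_nonneg (d i : ℕ) (u v : ZMod m) : 0 ≤ pairMean k n m p d i u v :=
  inputMean_nonneg fun L => mul_nonneg (levelCount_nonneg _ _ _ L) (levelCount_nonneg _ _ _ L)

/-- The indicators select the diagonal `b = a` and its translate `b = v - u + a`. These coincide if
`u = v` and are disjoint otherwise, so the `β²` term survives only in the first case. -/
theorem sum_sum_diagonal_le {R : Type*} [AddCommGroup R] [DecidableEq R] (W : Finset R) (u v : R)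
    {α β T : ℝ} (hα : 0 ≤ α) (hβ : 0 ≤ β) (hT : (W.card : ℝ) ≤ T) :
    ∑ a ∈ W, ∑ b ∈ W, (α + if a = b then β else 0) * (α + if u - a = v - b then β else 0)
      ≤ α ^ 2 * T ^ 2 + 2 * α * β * T + if u = v then β ^ 2 * T else 0 := by
  have hT0 : 0 ≤ T := (Nat.cast_nonneg _).trans hT
  have row (a : R) (ha : a ∈ W) : ∑ b ∈ W,
      (α + if a = b then β else 0) * (α + if u - a = v - b then β else 0)
      ≤ α ^ 2 * W.card + 2 * α * β + if u = v then β ^ 2 else 0 := by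
    have expand (b : R) :
        (α + if a = b then β else 0) * (α + if u - a = v - b then β else 0)
        = α ^ 2 + (if a = b then α * β + (if u = v then β ^ 2 else 0) else 0)
          + if b = v - u + a then α * β else 0 := by
      have e : u - a = v - b ↔ b = v - u + a := by
        constructor
        · intro h
          rw [sub_add, h, sub_sub_cancel]
        · rintro rfl
          abel
      simp only [← e]
      by_cases hab : a = b
      · subst hab
        simp only [sub_left_inj, if_true]
        split_ifs <;> ring
      · simp only [hab, if_false]
        split_ifs <;> ring
    simp only [expand, Finset.sum_add_distrib, Finset.sum_ite_eq, Finset.sum_ite_eq', ha, if_true,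
      Finset.sum_const, nsmul_eq_mul]
    have : (if v - u + a ∈ W then α * β else 0) ≤ α * β := by
      split_ifs
      · exact le_rfl
      · positivity
    linarith
  calc _ ≤ ∑ a ∈ W, (α ^ 2 * W.card + 2 * α * β + if u = v then β ^ 2 else 0) :=
        Finset.sum_le_sum row
    _ = W.card * (α ^ 2 * W.card + 2 * α * β + if u = v then β ^ 2 else 0) := by
        rw [Finset.sum_const, nsmul_eq_mul]
    _ ≤ T * (α ^ 2 * T + 2 * α * β + if u = v then β ^ 2 else 0) := by
        have : 0 ≤ if u = v then β ^ 2 else 0 := by split_ifs <;> positivity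
        gcongr
    _ = _ := by split_ifs <;> ring

/-- The form `α + [u = v] μ` is stable under the recursion: the product of the two diagonals gives
the new diagonal term, and the cross terms `2αμT` go into `overlap`. -/
theorem pairMean_le [NeZero m] (hm : Odd m) (h : TreeParams m p t) (hn : 0 < n)
    (hc : c = p * n) {d i : ℕ} (hd : d ≤ t) (hi : (i + 1) * 2 ^ d ≤ k) (u v : ZMod m) :
    pairMean k n m p d i u v ≤ if u ∈ window m p d ∧ v ∈ window m p d then
      (mass m p c d * (1 + p) ^ (2 ^ d - 1)) ^ 2 * overlap p c d
        + (if u = v then mass m p c d * (1 + p) ^ (2 ^ d - 1) else 0) else 0 := by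
  have hp := h.pos
  have hc0 : 0 < c := by rw [hc]; positivity
  have hm0 : (0 : ℝ) < m := by exact_mod_cast NeZero.pos m
  induction d generalizing i u v with
  | zero =>
    simp only [pow_zero, mul_one] at hi
    simpa [window_zero, mass_zero hp hc, overlap] using pairMean_zero_le hm p hi u v
  | succ d ih =>
    rw [pairMean_succ hm]
    by_cases hz : u ∈ window m p (d + 1) ∧ v ∈ window m p (d + 1)
    swap
    · rw [if_neg hz, if_neg hz]
    rw [if_pos hz, if_pos hz]
    obtain ⟨hi1, hi2⟩ := block_lt hi
    set μ := mass m p c d * (1 + p) ^ (2 ^ d - 1) with hμ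
    set α := μ ^ 2 * overlap p c d with hα
    have hmass := mass_pos (m := m) hp hc0 d
    have hμ0 : 0 < μ := by positivity
    have hG := one_le_overlap hp hc0 d
    have hα0 : 0 ≤ α := by positivity
    have hite (q : Prop) [Decidable q] : 0 ≤ if q then μ else 0 := by
      split_ifs <;> simp [hμ0.le]
    set T := p ^ d * m * (1 + p) with hT
    have hT0 : 0 < T := by positivity
    have hsucc : mass m p c (d + 1) * (1 + p) ^ (2 ^ (d + 1) - 1) = μ ^ 2 * T := by
      rw [mass_succ hp, hμ, two_pow_succ_pred, pow_succ (1 + p), pow_mul' (1 + p)]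
      ring
    -- Relative to the squared new mean, the cross terms weigh `2 * overlap p c d / (μ * T)`; `μ *
    -- T` is at least the ideal list length `c ^ 2 ^ d / p`.
    have hμT : 1 / (μ * T) ≤ p / c ^ 2 ^ d := by
      have e1 : μ * T = c ^ 2 ^ d / p * (1 + p) ^ (2 ^ d - 1) * (1 + p) := by
        rw [← mass_mul (m := m) hp d]; ring
      have e2 : c ^ 2 ^ d / p ≤ μ * T := by
        rw [e1, mul_assoc]
        refine le_mul_of_one_le_right (by positivity) ?_
        exact one_le_mul_of_one_le_of_one_le (one_le_pow₀ (by linarith)) (by linarith)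
      rw [← one_div_div (c ^ 2 ^ d) p]
      exact one_div_le_one_div_of_le (by positivity) e2
    calc _ ≤ ∑ a, ∑ b, if a ∈ window m p d ∧ b ∈ window m p d then
            (α + if a = b then μ else 0) * (α + if u - a = v - b then μ else 0) else 0 := by
          refine Finset.sum_le_sum fun a _ => Finset.sum_le_sum fun b _ => ?_
          have h1 := ih (by omega) hi1 a b
          have h2 := ih (by omega) hi2 (u - a) (v - b)
          -- The window condition on the second child is dropped; the one on the first child already
          -- restricts the sum.
          have h2' : pairMean k n m p d (2 * i + 1) (u - a) (v - b)
              ≤ α + if u - a = v - b then μ else 0 := by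
            refine h2.trans ?_
            have := hite (u - a = v - b)
            split_ifs at this ⊢ <;> linarith
          by_cases hab : a ∈ window m p d ∧ b ∈ window m p d
          · rw [if_pos hab] at h1 ⊢
            exact mul_le_mul h1 h2' (pairMean_nonneg _ _ _ _) (add_nonneg hα0 (hite _))
          · rw [if_neg hab] at h1 ⊢
            rw [le_antisymm h1 (pairMean_nonneg _ _ _ _), zero_mul]
      _ = ∑ a ∈ window m p d, ∑ b ∈ window m p d,
            (α + if a = b then μ else 0) * (α + if u - a = v - b then μ else 0) := by
          simp only [ite_and]
          rw [← Finset.sum_filter_add_sum_filter_not Finset.univ (· ∈ window m p d)]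
          rw [Finset.sum_congr (s₁ := Finset.univ.filter fun a => ¬ a ∈ window m p d) rfl
            (g := fun _ => 0) fun a ha => by simp [(Finset.mem_filter.1 ha).2]]
          rw [Finset.sum_const_zero, add_zero, Finset.filter_univ_mem]
          refine Finset.sum_congr rfl fun a ha => ?_
          simp only [ha, if_true, Finset.sum_ite_mem, Finset.univ_inter]
      _ ≤ α ^ 2 * T ^ 2 + 2 * α * μ * T + if u = v then μ ^ 2 * T else 0 :=
          sum_sum_diagonal_le _ u v hα0 hμ0.le (h.window_card_le (by omega))
      _ ≤ _ := by
          rw [hsucc]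
          refine add_le_add_left ?_ _
          have e : α ^ 2 * T ^ 2 + 2 * α * μ * T
              = (μ ^ 2 * T) ^ 2 * (overlap p c d ^ 2 + 2 * overlap p c d * (1 / (μ * T))) := by
            rw [hα]; field_simp
          rw [e, overlap]
          gcongr

/-- For `c ≥ 1` every correction is at most `x = p / c`, and `G² + 2Gx ≤ (G(1 + x))²` because `G ≥
1`. -/
theorem overlap_le_of_one_le (hp : 0 < p) (hc : 1 ≤ c) (d : ℕ) :
    overlap p c d ≤ (1 + p / c) ^ (2 * (2 ^ d - 1)) := by
  have hc0 : 0 < c := by linarith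
  induction d with
  | zero => simp [overlap]
  | succ d ih =>
    have hG := one_le_overlap hp hc0 d
    have hw : p / c ^ 2 ^ d ≤ p / c := by
      gcongr
      exact le_self_pow₀ hc (by positivity)
    have hx : 0 ≤ p / c := by positivity
    calc overlap p c (d + 1)
        ≤ overlap p c d ^ 2 + 2 * overlap p c d * (p / c) := by
          rw [overlap]
          gcongr
      _ ≤ (overlap p c d * (1 + p / c)) ^ 2 := by 
          have : 0 ≤ (overlap p c d - 1) * overlap p c d * (p / c) :=
            mul_nonneg (mul_nonneg (by linarith) (by linarith)) hx
          nlinarith [sq_nonneg (overlap p c d * (p / c))]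
      _ ≤ ((1 + p / c) ^ (2 * (2 ^ d - 1)) * (1 + p / c)) ^ 2 := by gcongr
      _ = _ := by
          rw [two_pow_succ_pred, ← pow_succ, ← pow_mul]
          ring

/-- For `c ≤ 1` the corrections `p * C` with `C = 1 / c ^ 2 ^ d` grow, but `C` squares at each step.
As `C ≥ 1`, `(1 + C y)² ≤ 1 + C² ((1 + y)² - 1)` for `y ≥ 0`, so the shape of the bound is
preserved. -/
theorem overlap_le_of_le_one (hp : 0 < p) (hc0 : 0 < c) (hc : c ≤ 1) (d : ℕ) :
    overlap p c d ≤ 1 + (1 / c ^ 2 ^ d) * ((1 + p) ^ (2 * (2 ^ d - 1)) - 1) := by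
  induction d with
  | zero => simp [overlap]
  | succ d ih =>
    have hG := one_le_overlap hp hc0 d
    have hC1 : 1 ≤ 1 / c ^ 2 ^ d := by
      rw [le_div_iff₀ (by positivity), one_mul]
      exact pow_le_one₀ hc0.le hc
    have hE1 : (1 : ℝ) ≤ (1 + p) ^ (2 * (2 ^ d - 1)) := one_le_pow₀ (by linarith)
    have hnext : (1 + p) ^ (2 * (2 ^ (d + 1) - 1)) = ((1 + p) ^ (2 * (2 ^ d - 1)) * (1 + p)) ^ 2 := by
      rw [two_pow_succ_pred, ← pow_succ, ← pow_mul]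
      ring
    have hCnext : 1 / c ^ 2 ^ (d + 1) = (1 / c ^ 2 ^ d) ^ 2 := by
      rw [pow_succ 2 d, pow_mul, div_pow, one_pow]
    rw [overlap, hnext, hCnext, div_eq_mul_one_div p]
    set C := 1 / c ^ 2 ^ d
    set E := (1 + p) ^ (2 * (2 ^ d - 1))
    set G := overlap p c d
    have hF : E + p ≤ E * (1 + p) := by nlinarith
    set F := E * (1 + p)
    calc G ^ 2 + 2 * G * (p * C) ≤ (G + p * C) ^ 2 := by nlinarith [sq_nonneg (p * C)]
      _ ≤ (1 + C * (F - 1)) ^ 2 := by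
          refine pow_le_pow_left₀ (by positivity) ?_ 2
          nlinarith
      _ ≤ 1 + C ^ 2 * (F ^ 2 - 1) := by
          have : 0 ≤ (C * (C - 1)) * (F - 1) :=
            mul_nonneg (mul_nonneg (by linarith) (by linarith)) (by linarith)
          nlinarith

end Bounds

/-! ### Bounds on the success probability. -/

section Conclusion

variable {k n m t : ℕ} {p c : ℝ}

/-- Cauchy–Schwarz for `f` and the indicator of its support, whose product is `f`. -/
theorem inputMean_sq_le (f : Inputs k n m → ℝ) :
    inputMean f ^ 2 ≤ (inputMean fun L => f L * f L) * inputMean ({L | f L ≠ 0}.indicator 1) := by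
  have h0 : (0 : ℝ) < Fintype.card (Inputs k n m) := by exact_mod_cast Fintype.card_pos
  have h := Finset.sum_mul_sq_le_sq_mul_sq Finset.univ f ({L | f L ≠ 0}.indicator 1)
  have e1 (L : Inputs k n m) : f L * ({L | f L ≠ 0}.indicator 1 L : ℝ) = f L := by
    by_cases hL : f L = 0 <;> simp [hL]
  have e2 (L : Inputs k n m) : ({L | f L ≠ 0}.indicator 1 L : ℝ) ^ 2
      = {L | f L ≠ 0}.indicator 1 L := by
    by_cases hL : f L = 0 <;> simp [hL]
  simp only [e1, e2] at h
  simp only [inputMean, Fintype.expect_eq_sum_div_card]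
  rw [div_pow, div_mul_div_comm, ← sq]
  simp only [← sq]
  gcongr

theorem successProb_eq [NeZero m] (ht : 0 < t) (hm : Odd m) (p : ℝ) :
    successProb (2 ^ t) n m p = inputMean
      ({L : Inputs (2 ^ t) n m | levelCount m p t 0 0 L ≠ 0}.indicator 1) := by
  rw [successProb, inputMeasure_real]
  congr 2
  ext L
  exact succeeds_iff ht hm p L

theorem TreeParams.mass_eq [NeZero m] (h : TreeParams m p t) : mass m p c t = c ^ 2 ^ t := by
  rw [mass, h.pow_mul, div_one]

theorem zero_mem_window [NeZero m] (hp : 0 < p) (d : ℕ) : (0 : ZMod m) ∈ window m p d := by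
  rw [mem_window, threshold_eq, ZMod.valMinAbs_zero, Int.cast_zero, abs_zero]
  positivity

theorem successProb_le [NeZero m] (ht : 0 < t) (hm : Odd m) (h : TreeParams m p t) (hn : 0 < n)
    (hc : c = p * n) : successProb (2 ^ t) n m p ≤ c ^ 2 ^ t * (1 + 37 * p) ^ 2 ^ t := by
  have hp := h.pos
  have hc0 : 0 < c := by rw [hc]; positivity
  rw [successProb_eq ht hm]
  calc _ ≤ inputMean (levelCount (k := 2 ^ t) (n := n) m p t 0 0) := by
        refine inputMean_mono fun L => Set.indicator_le' (fun L hL => ?_) (fun L _ => ?_) L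
        · simp only [levelCount, Set.mem_ofPred_eq, Nat.cast_ne_zero] at hL
          simp only [levelCount, Pi.one_apply, Nat.one_le_cast]
          omega
        · exact levelCount_nonneg _ _ _ _
    _ ≤ c ^ 2 ^ t * (1 + p) ^ (2 ^ t - 1) := by
        have := inputMean_levelCount_le (k := 2 ^ t) hm h hn hc le_rfl (i := 0) (by simp) 0
        rwa [if_pos (zero_mem_window hp t), h.mass_eq] at this
    _ ≤ c ^ 2 ^ t * (1 + p) ^ 2 ^ t := by
        gcongr
        · linarith
        · exact Nat.sub_le _ _
    _ ≤ _ := by gcongr; linarith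

theorem overlap_add_le (hp : 0 < p) (hn : 0 < n) (hc : c = p * n) (ht : 2 ≤ t) :
    overlap p c t + (c ^ 2 ^ t)⁻¹
      ≤ ((c ^ 2 ^ t)⁻¹ + (1 + (2 : ℝ) ^ t / n) ^ 2 ^ t) * (1 + p) ^ (2 * 2 ^ t) := by
  have hn0 : (0 : ℝ) < n := by exact_mod_cast hn
  have hn1 : (1 : ℝ) ≤ n := by exact_mod_cast hn
  have hc0 : 0 < c := by rw [hc]; positivity
  have hE : 1 ≤ (1 + p) ^ (2 * 2 ^ t) := one_le_pow₀ (by linarith)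
  have hA : 1 ≤ (1 + (2 : ℝ) ^ t / n) ^ 2 ^ t := one_le_pow₀ (le_add_of_nonneg_right (by positivity))
  have hC : 0 < (c ^ 2 ^ t)⁻¹ := by positivity
  rcases le_total 1 c with h1 | h1
  · have hpc : p / c = 1 / n := by rw [hc]; field_simp
    have h4 : (4 : ℝ) ≤ 2 ^ t := by
      calc (4 : ℝ) = 2 ^ 2 := by norm_num
        _ ≤ 2 ^ t := pow_le_pow_right₀ (by norm_num) ht
    -- Here `k ≥ 4` enters: the square is at most `1 + 3 / n`, which `1 + k / n` dominates.
    have hbase : (1 + 1 / (n : ℝ)) ^ 2 ≤ 1 + (2 : ℝ) ^ t / n := by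
      have e : (1 + 1 / (n : ℝ)) ^ 2 = 1 + (2 + 1 / n) / n := by field_simp; ring
      have : 1 / (n : ℝ) ≤ 1 := by rw [div_le_one hn0]; exact hn1
      rw [e]
      gcongr
      linarith
    have := calc overlap p c t ≤ (1 + 1 / (n : ℝ)) ^ (2 * (2 ^ t - 1)) :=
            hpc ▸ overlap_le_of_one_le hp h1 t
      _ ≤ (1 + 1 / (n : ℝ)) ^ (2 * 2 ^ t) := by
            refine pow_le_pow_right₀ (le_add_of_nonneg_right (by positivity)) (by omega)
      _ ≤ (1 + (2 : ℝ) ^ t / n) ^ 2 ^ t := by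
            rw [pow_mul]
            gcongr
    nlinarith
  · have := overlap_le_of_le_one hp hc0 h1 t
    have hmono : (1 + p) ^ (2 * (2 ^ t - 1)) ≤ (1 + p) ^ (2 * 2 ^ t) :=
      pow_le_pow_right₀ (by linarith) (by omega)
    rw [one_div] at this
    -- With `C` the inverse power and `E` the power of `1 + p`, the left side is at most `1 + C(E -
    -- 1) + C = 1 + C E`.
    nlinarith [mul_le_mul_of_nonneg_left hmono hC.le]

theorem le_successProb [NeZero m] (ht : 2 ≤ t) (hm : Odd m) (h : TreeParams m p t) (hn : 0 < n)
    (hc : c = p * n) :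
    1 / ((c ^ 2 ^ t)⁻¹ + (1 + (2 : ℝ) ^ t / n) ^ 2 ^ t) * (max 0 (1 - 150 * p)) ^ 2 ^ t
      ≤ successProb (2 ^ t) n m p := by
  have hp := h.pos
  have hp1 := h.le
  have hc0 : 0 < c := by rw [hc]; positivity
  have h2p : 0 ≤ 1 - 2 * p := by linarith
  have hS := inputMean_sq_le (levelCount (k := 2 ^ t) (n := n) m p t 0 0)
  rw [← successProb_eq (by omega) hm] at hS
  set P := successProb (2 ^ t) n m p
  set D := (c ^ 2 ^ t)⁻¹ + (1 + (2 : ℝ) ^ t / n) ^ 2 ^ t with hD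
  have hD0 : 0 < D := by positivity
  have hP0 : 0 ≤ P := measureReal_nonneg
  have hlow := le_inputMean_levelCount (k := 2 ^ t) hm h hn hc le_rfl (i := 0) (by simp) 0
    (zero_mem_window hp t)
  have hpair := pairMean_le (k := 2 ^ t) hm h hn hc le_rfl (i := 0) (by simp) 0 0
  rw [if_pos ⟨zero_mem_window hp t, zero_mem_window hp t⟩, if_pos rfl] at hpair
  rw [h.mass_eq] at hlow hpair
  have hover := overlap_add_le hp hn hc ht
  rw [← hD] at hover
  set K := 2 ^ t
  have hCK : 0 < c ^ K := by positivity
  have hone : (1 : ℝ) ≤ (1 + p) ^ (K - 1) := one_le_pow₀ (by linarith)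
  -- The exponent `4 * K` is `2 * K` from the squared mean plus `2 * K` from `overlap_add_le`; the
  -- diagonal term is enlarged to share the first factor.
  have hsecond : pairMean (2 ^ t) n m p t 0 0 0 ≤ (c ^ K) ^ 2 * ((1 + p) ^ (4 * K) * D) := by
    calc _ ≤ (c ^ K * (1 + p) ^ (K - 1)) ^ 2 * overlap p c t + c ^ K * (1 + p) ^ (K - 1) := hpair
      _ ≤ (c ^ K * (1 + p) ^ (K - 1)) ^ 2 * overlap p c t + c ^ K * ((1 + p) ^ (K - 1)) ^ 2 := by
          gcongr
          exact le_self_pow₀ hone two_ne_zero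
      _ = (c ^ K) ^ 2 * (((1 + p) ^ (K - 1)) ^ 2 * (overlap p c t + (c ^ K)⁻¹)) := by
          field_simp
      _ ≤ (c ^ K) ^ 2 * (((1 + p) ^ K) ^ 2 * (D * (1 + p) ^ (2 * K))) := by
          have := one_le_overlap hp hc0 t
          gcongr
          · linarith
          · exact Nat.sub_le _ _
      _ = _ := by ring
  have hfirst : (c ^ K) ^ 2 * ((1 - 2 * p) ^ 2) ^ K
      ≤ inputMean (levelCount (k := 2 ^ t) (n := n) m p t 0 0) ^ 2 := by
    calc _ = (c ^ K * (1 - 2 * p) ^ K) ^ 2 := by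
          rw [mul_pow, pow_right_comm (1 - 2 * p)]
      _ ≤ (c ^ K * (1 - 2 * p) ^ (K - 1)) ^ 2 := by
          refine pow_le_pow_left₀ (by positivity) (mul_le_mul_of_nonneg_left ?_ hCK.le) 2
          exact pow_le_pow_of_le_one h2p (by linarith) (Nat.sub_le _ _)
      _ ≤ _ := pow_le_pow_left₀ (by positivity) hlow 2
  have hmain : ((1 - 2 * p) ^ 2) ^ K ≤ (1 + p) ^ (4 * K) * D * P := by
    have : (c ^ K) ^ 2 * ((1 - 2 * p) ^ 2) ^ K ≤ (c ^ K) ^ 2 * ((1 + p) ^ (4 * K) * D * P) := by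
      refine hfirst.trans (hS.trans ?_)
      rw [← mul_assoc]
      exact mul_le_mul_of_nonneg_right hsecond hP0
    exact le_of_mul_le_mul_left this (by positivity)
  -- The constant `150` leaves ample room; truncation at `0` matters because `p ≤ 1 / 30` allows
  -- `150 * p > 1`.
  have hbase : (1 + p) ^ 4 * max 0 (1 - 150 * p) ≤ (1 - 2 * p) ^ 2 := by
    rcases le_total 0 (1 - 150 * p) with hq | hq
    · rw [max_eq_right hq]
      have h2 : (1 + p) ^ 2 ≤ 1 + 3 * p := by nlinarith
      have h4 : (1 + p) ^ 4 ≤ 1 + 15 * p := by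
        calc (1 + p) ^ 4 = ((1 + p) ^ 2) ^ 2 := by ring
          _ ≤ (1 + 3 * p) ^ 2 := by gcongr
          _ ≤ 1 + 15 * p := by nlinarith
      calc _ ≤ (1 + 15 * p) * (1 - 150 * p) := by gcongr
        _ ≤ _ := by nlinarith
    · rw [max_eq_left hq, mul_zero]
      positivity
  have hbaseK : (1 + p) ^ (4 * K) * (max 0 (1 - 150 * p)) ^ K ≤ ((1 - 2 * p) ^ 2) ^ K := by
    rw [pow_mul, ← mul_pow]
    gcongr
  rw [one_div, inv_mul_le_iff₀ hD0]
  have := hbaseK.trans hmain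
  rw [mul_assoc] at this
  exact le_of_mul_le_mul_left this (by positivity)

/-! ### Expected list lengths and total complexity. -/

/-- The expected length of list `i` after `d` iterations. -/
def meanLength (k n m : ℕ) (p : ℝ) (d i : ℕ) : ℝ :=
  inputMean fun L : Inputs k n m => ((level m p L.lists d i).length : ℝ)

theorem meanLength_eq [NeZero m] (d i : ℕ) : meanLength k n m p d i
    = ∑ z, inputMean (levelCount (k := k) (n := n) m p d i z) := by
  rw [meanLength, ← inputMean_sum]
  congr 1
  ext L
  simp only [levelCount]
  exact_mod_cast length_eq_sum_countResidue _

theorem meanLength_le [NeZero m] (hm : Odd m) (h : TreeParams m p t) (hn : 0 < n)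
    (hc : c = p * n) {d i : ℕ} (hd : d ≤ t) (hi : (i + 1) * 2 ^ d ≤ k) :
    meanLength k n m p d i ≤ c ^ 2 ^ d / p * (1 + p) ^ 2 ^ d := by
  have hp := h.pos
  have hc0 : 0 < c := by rw [hc]; positivity
  have := mass_pos (m := m) hp hc0 d
  rw [meanLength_eq]
  calc _ ≤ ∑ z, if z ∈ window m p d then mass m p c d * (1 + p) ^ (2 ^ d - 1) else 0 :=
        Finset.sum_le_sum fun z _ => inputMean_levelCount_le hm h hn hc hd hi z
    _ = mass m p c d * (1 + p) ^ (2 ^ d - 1) * (window m p d).card := by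
        simp [Finset.sum_ite_mem]; ring
    _ ≤ mass m p c d * (1 + p) ^ (2 ^ d - 1) * (p ^ d * m * (1 + p)) := by
        gcongr
        exact h.window_card_le hd
    _ = mass m p c d * (p ^ d * m) * ((1 + p) ^ (2 ^ d - 1) * (1 + p)) := by ring
    _ = _ := by rw [mass_mul hp, ← pow_succ, Nat.sub_add_cancel Nat.one_le_two_pow]

theorem le_meanLength [NeZero m] (hm : Odd m) (h : TreeParams m p t) (hn : 0 < n)
    (hc : c = p * n) {d i : ℕ} (hd : d ≤ t) (hi : (i + 1) * 2 ^ d ≤ k) :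
    c ^ 2 ^ d / p * (1 - 2 * p) ^ 2 ^ d ≤ meanLength k n m p d i := by
  have hp := h.pos
  have hp1 := h.le
  have hc0 : 0 < c := by rw [hc]; positivity
  have h2p : 0 ≤ 1 - 2 * p := by linarith
  have := mass_pos (m := m) hp hc0 d
  rw [meanLength_eq]
  calc _ = mass m p c d * (1 - 2 * p) ^ (2 ^ d - 1) * (p ^ d * m * (1 - 2 * p)) := by
        rw [← mass_mul (m := m) hp]
        nth_rw 1 [← Nat.sub_add_cancel (Nat.one_le_two_pow (n := d))]
        rw [pow_succ (1 - 2 * p)]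
        ring
    _ ≤ mass m p c d * (1 - 2 * p) ^ (2 ^ d - 1) * (window m p d).card := by
        gcongr
        refine le_trans ?_ (h.le_window_card hd)
        gcongr
        linarith
    _ = ∑ z ∈ window m p d, mass m p c d * (1 - 2 * p) ^ (2 ^ d - 1) := by
        rw [Finset.sum_const, nsmul_eq_mul, mul_comm]
    _ ≤ ∑ z ∈ window m p d, inputMean (levelCount (k := k) (n := n) m p d i z) :=
        Finset.sum_le_sum fun z hz => le_inputMean_levelCount hm h hn hc hd hi z hz
    _ ≤ _ := Finset.sum_le_sum_of_subset_of_nonneg (Finset.subset_univ _) fun z _ _ =>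
        inputMean_nonneg (levelCount_nonneg _ _ _)

theorem expectedComplexity_eq (t n m : ℕ) (p : ℝ) : expectedComplexity (2 ^ t) n m p
    = ∑ d ∈ Finset.range (t + 1), ∑ i ∈ Finset.range (2 ^ t / 2 ^ d),
        meanLength (2 ^ t) n m p d i := by
  rw [expectedComplexity, integral_inputMeasure]
  simp only [meanLength, ← inputMean_sum]
  congr 1
  ext L
  rw [totalSize, Nat.log_pow (by norm_num)]
  push_cast
  rfl

/-- Since `c = p * n`, the ideal length `c ^ 2 ^ d / p` equals `n * c ^ (2 ^ d - 1)`, and depth `d`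
has `2 ^ t / 2 ^ d` lists; the inputs give the summand `1`. -/
theorem sum_levels_eq (hp : 0 < p) (hc : c = p * n) (t : ℕ) (E : ℝ) :
    ∑ d ∈ Finset.range (t + 1), ∑ _i ∈ Finset.range (2 ^ t / 2 ^ d), c ^ 2 ^ d / p * E
      = 2 ^ t * n * (1 + ∑ d ∈ Finset.Icc 1 t, c ^ (2 ^ d - 1) / 2 ^ d) * E := by
  have term (d : ℕ) (hd : d ≤ t) : ∑ _i ∈ Finset.range (2 ^ t / 2 ^ d), c ^ 2 ^ d / p * E
      = 2 ^ t * n * E * (c ^ (2 ^ d - 1) / 2 ^ d) := by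
    have e : c ^ 2 ^ d = c ^ (2 ^ d - 1) * (p * n) := by
      rw [← hc, ← pow_succ, Nat.sub_add_cancel Nat.one_le_two_pow]
    rw [Finset.sum_const, Finset.card_range, nsmul_eq_mul,
      Nat.cast_div (pow_dvd_pow 2 hd) (by positivity), e]
    push_cast
    field_simp
  rw [Finset.sum_congr rfl fun d hd => term d (by rw [Finset.mem_range] at hd; omega),
    ← Finset.mul_sum, Finset.sum_range_succ',
    show Finset.Icc 1 t = Finset.Ico 1 (t + 1) by ext; simp, Finset.sum_Ico_eq_sum_range]
  simp only [add_comm 1, add_tsub_cancel_right, pow_zero, tsub_self, div_one]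
  ring

theorem mem_block {t d i : ℕ} (hi : i ∈ Finset.range (2 ^ t / 2 ^ d)) :
    (i + 1) * 2 ^ d ≤ 2 ^ t :=
  (Nat.le_div_iff_mul_le (by positivity)).1 (Finset.mem_range.1 hi)

theorem expectedComplexity_le [NeZero m] (ht : 1 ≤ t) (hm : Odd m) (h : TreeParams m p t)
    (hn : 0 < n) (hc : c = p * n) : expectedComplexity (2 ^ t) n m p
      ≤ 2 ^ t * n * (1 + ∑ d ∈ Finset.Icc 1 t, c ^ (2 ^ d - 1) / 2 ^ d)
        * (1 + 37 * p) ^ (2 ^ t - 1) := by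
  have hp := h.pos
  have hp1 := h.le
  have hc0 : 0 < c := by rw [hc]; positivity
  rw [expectedComplexity_eq, ← sum_levels_eq hp hc]
  refine Finset.sum_le_sum fun d hd => Finset.sum_le_sum fun i hi => ?_
  have hdt : d ≤ t := by rw [Finset.mem_range] at hd; omega
  refine (meanLength_le hm h hn hc hdt (mem_block hi)).trans ?_
  gcongr
  -- At `d = t` the exponent `2 ^ d` exceeds `2 ^ t - 1` by one; squaring the base makes up for it,
  -- and `37` absorbs the square.
  have h2 : 2 ^ d ≤ 2 * (2 ^ t - 1) := by
    have h3 := Nat.pow_le_pow_right (n := 2) (by norm_num) hdt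
    have h4 := Nat.pow_le_pow_right (n := 2) (by norm_num) ht
    omega
  calc (1 + p) ^ 2 ^ d ≤ (1 + p) ^ (2 * (2 ^ t - 1)) := pow_le_pow_right₀ (by linarith) h2
    _ = ((1 + p) ^ 2) ^ (2 ^ t - 1) := pow_mul _ _ _
    _ ≤ _ := by
        gcongr
        nlinarith

theorem le_expectedComplexity [NeZero m] (ht : 1 ≤ t) (hm : Odd m) (h : TreeParams m p t)
    (hn : 0 < n) (hc : c = p * n) :
    2 ^ t * n * (1 + ∑ d ∈ Finset.Icc 1 t, c ^ (2 ^ d - 1) / 2 ^ d) * (1 - 37 * p) ^ (2 ^ t - 1)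
      ≤ expectedComplexity (2 ^ t) n m p := by
  have hp := h.pos
  have hp1 := h.le
  have hc0 : 0 < c := by rw [hc]; positivity
  have h2p : 0 ≤ 1 - 2 * p := by linarith
  rw [expectedComplexity_eq, ← sum_levels_eq hp hc]
  refine Finset.sum_le_sum fun d hd => Finset.sum_le_sum fun i hi => ?_
  have hdt : d ≤ t := by rw [Finset.mem_range] at hd; omega
  refine le_trans ?_ (le_meanLength hm h hn hc hdt (mem_block hi))
  refine mul_le_mul_of_nonneg_left ?_ (by positivity)
  have h4 := Nat.pow_le_pow_right (n := 2) (by norm_num) ht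
  have h2 : 2 ^ d ≤ 2 * (2 ^ t - 1) := by
    have h3 := Nat.pow_le_pow_right (n := 2) (by norm_num) hdt
    omega
  have hpos : 0 ≤ (1 - 2 * p) ^ 2 ^ d := by positivity
  rcases le_total 0 (1 - 37 * p) with hq | hq
  · calc (1 - 37 * p) ^ (2 ^ t - 1) ≤ ((1 - 2 * p) ^ 2) ^ (2 ^ t - 1) := by
          gcongr
          nlinarith
      _ = (1 - 2 * p) ^ (2 * (2 ^ t - 1)) := (pow_mul _ _ _).symm
      _ ≤ _ := pow_le_pow_of_le_one h2p (by linarith) h2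
  -- If `37 * p ≥ 1` the bound is trivial, as the exponent `2 ^ t - 1` is odd.
  · refine le_trans (Odd.pow_nonpos ?_ hq) hpos
    obtain ⟨s, rfl⟩ : ∃ s, t = s + 1 := ⟨t - 1, by omega⟩
    exact ⟨2 ^ s - 1, two_pow_succ_pred s⟩

/-- The choice of `p` makes `p ^ (t + 1) * m = 1`, whence `m > 30 ^ (t + 1)` forces `p ≤ 1 / 30`. -/
theorem treeParams_rpow (hm : 30 ^ (t + 1) < m) (hp : p = (m : ℝ) ^ (-1 / ((t : ℝ) + 1))) :
    TreeParams m p t := by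
  have hm0 : (0 : ℝ) < m := by exact_mod_cast (Nat.zero_le _).trans_lt hm
  have hp0 : 0 < p := by rw [hp]; positivity
  have hpow : p ^ (t + 1) * m = 1 := by
    rw [hp, ← Real.rpow_natCast, ← Real.rpow_mul hm0.le]
    push_cast
    rw [div_mul_cancel₀ _ (by positivity), Real.rpow_neg_one, inv_mul_cancel₀ hm0.ne']
  refine ⟨hp0, ?_, hpow⟩
  by_contra! hlt
  have h1 : (1 / 30 : ℝ) ^ (t + 1) < p ^ (t + 1) := by
    gcongr
  have h2 : (30 : ℝ) ^ (t + 1) < m := by exact_mod_cast hm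
  have h3 : (1 : ℝ) < p ^ (t + 1) * m := by
    calc (1 : ℝ) = (1 / 30 : ℝ) ^ (t + 1) * 30 ^ (t + 1) := by rw [← mul_pow]; norm_num
      _ < p ^ (t + 1) * m := by gcongr
  linarith

end Conclusion
end KTree
end

theorem theorem2p4 (k n m : ℕ) (hk : ∃ t : ℕ, k = 2 ^ t) (hk4 : 4 ≤ k) (hn : 1 ≤ n)
    (hm : 30 ^ (Nat.log 2 k + 1) < m) (hmodd : Odd m)
    (p c : ℝ) (hp : p = (m : ℝ) ^ (-1 / ((Nat.log 2 k : ℝ) + 1))) (hc : c = p * n) :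
    (1 / (c ^ (-(k : ℤ)) + (1 + (k : ℝ) / n) ^ k) * (max 0 (1 - 150 * p)) ^ k
        ≤ KTree.successProb k n m p ∧
      KTree.successProb k n m p ≤ c ^ k * (1 + 37 * p) ^ k) ∧
    ((k : ℝ) * n * (1 + ∑ d ∈ Finset.Icc 1 (Nat.log 2 k), c ^ (2 ^ d - 1) / 2 ^ d)
          * (1 - 37 * p) ^ (k - 1)
        ≤ KTree.expectedComplexity k n m p ∧
      KTree.expectedComplexity k n m p
        ≤ (k : ℝ) * n * (1 + ∑ d ∈ Finset.Icc 1 (Nat.log 2 k), c ^ (2 ^ d - 1) / 2 ^ d)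
          * (1 + 37 * p) ^ (k - 1)) := by
  obtain ⟨t, rfl⟩ := hk
  have : NeZero m := ⟨by rintro rfl; simp at hmodd⟩
  have ht : 2 ≤ t := by
    by_contra! hlt
    interval_cases t <;> simp at hk4
  rw [Nat.log_pow (by norm_num)] at hm hp ⊢
  have h := KTree.treeParams_rpow hm hp
  have hcast : ((2 ^ t : ℕ) : ℝ) = 2 ^ t := by push_cast; rfl
  rw [zpow_neg, zpow_natCast, hcast]
  exact ⟨⟨KTree.le_successProb ht hmodd h hn hc, KTree.successProb_le (by omega) hmodd h hn hc⟩,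
    KTree.le_expectedComplexity (by omega) hmodd h hn hc,
    KTree.expectedComplexity_le (by omega) hmodd h hn hc⟩
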